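/- Let $G$ be a finite simple graph with vertex set $V$ and edge set $E$. A subgraph of $G$ here means a spanning subgraph, i.e. a graph $(V,X)$ with $X\subseteq E$; an orientation of $G$ is a digraph obtained by assigning to each edge of $G$ exactly one of its two directions. For $k\in\mathbb{N}=\{0,1,2,\dots\}$, a graph is $k$-edge-connected if it remains connected (any two of its vertices are joined by a path) whenever fewer than $k$ edges are removed, and a digraph is $k$-arc-strong if for every two vertices $u,v$ there exist $k$ pairwise arc-disjoint directed paths from $u$ to $v$ (for $u=v$ the condition holds trivially). Then for every $k\in\mathbb{N}$: $$\#\{2k\text{-edge-connected subgraphs of }G\}\;\le\;\#\{k\text{-arc-strong orientations of }G\}\;\le\;\#\{k\text{-edge-connected subgraphs of }G\}.$$ In particular, calling a digraph strong if for every two vertices $u,v$ it has a directed path from $u$ to $v$, $$\#\{2\text{-edge-connected subgraphs of }G\}\;\le\;\#\{\text{strong orientations of }G\}\;\le\;\#\{\text{connected subgraphs of }G\}.$$ -/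

import Mathlib

namespace Digraph

/-- `D` is an orientation of the simple graph `G`: every edge of `G` receives exactly one of its two
directions, and `D` has no other arcs. -/
structure IsOrientationOf {V : Type*} (D : Digraph V) (G : SimpleGraph V) : Prop where
  adj_iff : ∀ u v, G.Adj u v ↔ D.Adj u v ∨ D.Adj v u
  asymm : ∀ u v, D.Adj u v → ¬ D.Adj v u

/-- The list of vertices `p` is a directed path of `D` from `u` to `v`. The one-vertex list `[u]`
is the trivial path from `u` to `u`. -/
structure IsPath {V : Type*} (D : Digraph V) (u v : V) (p : List V) : Prop where
  head_eq : p.head? = some u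
  getLast_eq : p.getLast? = some v
  chain : p.IsChain D.Adj
  nodup : p.Nodup

/-- The arcs traversed by a list of vertices: the pairs of consecutive vertices. -/
def arcs {V : Type*} (p : List V) : List (V × V) := p.zip p.tail

/-- `D` is `k`-arc-strong: for all `u`, `v` there are `k` pairwise arc-disjoint directed paths
from `u` to `v`. -/
def IsArcStrong {V : Type*} (D : Digraph V) (k : ℕ) : Prop :=
  ∀ u v : V, ∃ P : Fin k → List V, (∀ i, D.IsPath u v (P i)) ∧
    ∀ i j, i ≠ j → List.Disjoint (arcs (P i)) (arcs (P j))

/-- `D` is strongly connected: for all `u`, `v` there is a directed path from `u` to `v`. -/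
def IsStrong {V : Type*} (D : Digraph V) : Prop :=
  ∀ u v : V, ∃ p : List V, D.IsPath u v p

end Digraph

/-! Relative to a linear order on the vertices, an orientation of `G` is the set of its edges
directed upwards, so a property of orientations is a family of edge sets. By Pajor's inequality a
family has at most as many members as it shatters sets; applied to the complementary family, this
bounds it below by the number of strongly shattered sets (`ncard_orientations_le`,
`le_ncard_orientations`).

Upper bound: suppose every orientation of the edges outside `H` extends to a `k`-arc-strong one. If
fewer than `k` edges disconnected `H`, direct all edges outside `H` one way across the resulting
cut; `k` arc-disjoint paths going the other way would need `k` distinct deleted edges.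

Lower bound: by Nash-Williams (`WeightedGraph.orientable`), a `2 * k`-edge-connected `H` has a
`k`-arc-strong orientation, which stays so however the other edges of `G` are directed. That theorem
is proved for cuts of weighted graphs, by Lovász's splitting-off; Menger's theorem turns cuts into
arc-disjoint paths. -/

open Finset

/-! ### Directed paths, integral flows and Menger's theorem. -/

namespace Digraph

variable {V : Type*}

lemma arcs_cons_cons (a b : V) (l : List V) : arcs (a :: b :: l) = (a, b) :: arcs (b :: l) := rfl

lemma mem_of_mem_arcs {p : List V} {x y : V} (h : (x, y) ∈ arcs p) : x ∈ p ∧ y ∈ p :=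
  ⟨(List.of_mem_zip h).1, List.mem_of_mem_tail (List.of_mem_zip h).2⟩

lemma nodup_arcs {p : List V} (hp : p.Nodup) : (arcs p).Nodup := by
  induction p with
  | nil => exact List.nodup_nil
  | cons a l ih =>
    cases l with
    | nil => exact List.nodup_nil
    | cons b l =>
      rw [arcs_cons_cons, List.nodup_cons]
      rw [List.nodup_cons] at hp
      exact ⟨fun h ↦ hp.1 (mem_of_mem_arcs h).1, ih hp.2⟩

lemma adj_of_mem_arcs {D : Digraph V} {p : List V} (hp : p.IsChain D.Adj) {x y : V}
    (h : (x, y) ∈ arcs p) : D.Adj x y := by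
  induction p with
  | nil => simp [arcs] at h
  | cons a l ih =>
    cases l with
    | nil => simp [arcs] at h
    | cons b l =>
      rw [arcs_cons_cons, List.mem_cons] at h
      rw [List.isChain_cons_cons] at hp
      rcases h with h | h
      · cases h; exact hp.1
      · exact ih hp.2 h

/-- A path that leaves a set traverses an arc that leaves it. -/
lemma IsPath.exists_mem_arcs {D : Digraph V} {u v : V} {p : List V} (hp : D.IsPath u v p)
    {X : Set V} (hu : u ∈ X) (hv : v ∉ X) : ∃ x y, (x, y) ∈ arcs p ∧ x ∈ X ∧ y ∉ X := by
  obtain ⟨h1, h2, -, -⟩ := hp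
  induction p generalizing u with
  | nil => simp at h1
  | cons a l ih =>
    obtain rfl : a = u := by simpa using h1
    cases l with
    | nil =>
      obtain rfl : a = v := by simpa using h2
      exact absurd hu hv
    | cons b l =>
      by_cases hb : b ∈ X
      · obtain ⟨x, y, h, hx⟩ := ih hb rfl (by simpa using h2)
        exact ⟨x, y, by rw [arcs_cons_cons]; exact List.mem_cons_of_mem _ h, hx⟩
      · exact ⟨a, b, by rw [arcs_cons_cons]; exact List.mem_cons_self, hu, hb⟩

lemma IsPath.mono {D D' : Digraph V} (h : ∀ x y, D.Adj x y → D'.Adj x y) {u v : V} {p : List V}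
    (hp : D.IsPath u v p) : D'.IsPath u v p :=
  ⟨hp.head_eq, hp.getLast_eq, hp.chain.imp h, hp.nodup⟩

/-- A vertex reachable by a walk is reachable by a path. -/
lemma exists_isPath_of_reflTransGen {D : Digraph V} {u v : V}
    (h : Relation.ReflTransGen D.Adj u v) : ∃ p, D.IsPath u v p := by
  classical
  induction h using Relation.ReflTransGen.head_induction_on with
  | refl => exact ⟨[v], rfl, rfl, List.isChain_singleton _, List.nodup_singleton _⟩
  | @head a b hab _ ih =>
    obtain ⟨p, h1, h2, h3, h4⟩ := ih
    -- If the walk returns to `a`, only the part of `p` from `a` on is kept.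
    by_cases ha : a ∈ p
    · obtain ⟨s, t, rfl⟩ := List.append_of_mem ha
      refine ⟨a :: t, rfl, ?_, ?_, ?_⟩
      · simpa [List.getLast?_append] using h2
      · exact h3.right_of_append
      · exact (List.nodup_append.1 h4).2.1
    · cases p with
      | nil => simp at h1
      | cons c l =>
        obtain rfl : c = b := by simpa using h1
        exact ⟨a :: c :: l, rfl, by simpa using h2, List.isChain_cons_cons.2 ⟨hab, h3⟩,
          List.nodup_cons.2 ⟨ha, h4⟩⟩

/-- If `v` is not reachable from `u`, some set contains `u`, misses `v`, and has no leaving arcs. -/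
lemma exists_isPath_of_forall_cut [Fintype V] [DecidableEq V] {D : Digraph V} {u v : V}
    (h : ∀ X : Finset V, u ∈ X → v ∉ X → ∃ x ∈ X, ∃ y ∉ X, D.Adj x y) :
    ∃ p, D.IsPath u v p := by
  classical
  apply exists_isPath_of_reflTransGen
  by_contra hv
  obtain ⟨x, hx, y, hy, hxy⟩ := h (univ.filter fun w ↦ Relation.ReflTransGen D.Adj u w)
    (by simp [Relation.ReflTransGen.refl]) (by simpa using hv)
  simp only [mem_filter, mem_univ, true_and] at hx hy
  exact hy (hx.tail hxy)

section Flow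

variable [DecidableEq V]

/-- The net flow carried by a list of vertices. -/
def arcFlow (p : List V) (x y : V) : ℤ := (arcs p).count (x, y) - (arcs p).count (y, x)

lemma arcFlow_antisymm (p : List V) (x y : V) : arcFlow p y x = -arcFlow p x y := by
  simp [arcFlow]

lemma arcFlow_le {p : List V} (hp : p.Nodup) (x y : V) :
    arcFlow p x y ≤ if (x, y) ∈ arcs p then 1 else 0 := by
  have h := List.nodup_iff_count_le_one.1 (nodup_arcs hp) (x, y)
  unfold arcFlow
  split_ifs with hxy
  · omega
  · rw [List.count_eq_zero_of_not_mem hxy]; omega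

/-- Sum over a set of a divergence concentrated at a source inside and a sink outside. -/
lemma sum_source_sub_sink {u v : V} {X : Finset V} (hu : u ∈ X) (hv : v ∉ X) (k : ℤ) :
    ∑ x ∈ X, k * ((if x = u then 1 else 0) - (if x = v then 1 else 0)) = k := by
  rw [← mul_sum, sum_sub_distrib]
  simp [hu, hv]

variable [Fintype V]

lemma sum_arcFlow {D : Digraph V} {u v : V} {p : List V} (hp : D.IsPath u v p) (x : V) :
    ∑ y, arcFlow p x y = (if x = u then 1 else 0) - (if x = v then 1 else 0) := by
  obtain ⟨h1, h2, -, -⟩ := hp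
  induction p generalizing u with
  | nil => simp at h1
  | cons a l ih =>
    obtain rfl : a = u := by simpa using h1
    cases l with
    | nil =>
      obtain rfl : a = v := by simpa using h2
      simp [arcFlow, arcs]
    | cons b l =>
      have key : ∀ y, arcFlow (a :: b :: l) x y = arcFlow (b :: l) x y +
          ((if y = b then if x = a then 1 else 0 else 0) -
            (if y = a then if x = b then 1 else 0 else 0)) := by
        intro y
        unfold arcFlow
        rw [arcs_cons_cons, List.count_cons, List.count_cons]
        simp only [beq_iff_eq, Prod.mk.injEq]
        grind
      simp_rw [key]
      rw [sum_add_distrib, sum_sub_distrib, ih rfl (by simpa using h2)]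
      simp

/-- The amount of a net flow that leaves a set is the sum of its divergences on the set. -/
lemma sum_sum_compl_eq {g : V → V → ℤ} (hg : ∀ x y, g y x = -g x y) (X : Finset V) :
    ∑ x ∈ X, ∑ y ∈ Xᶜ, g x y = ∑ x ∈ X, ∑ y, g x y := by
  -- By antisymmetry the flow inside `X` cancels.
  have h0 : ∑ x ∈ X, ∑ y ∈ X, g x y = 0 := by
    have h := sum_comm (s := X) (t := X) (f := g)
    have h' : ∑ y ∈ X, ∑ x ∈ X, g x y = -∑ y ∈ X, ∑ x ∈ X, g y x := by
      simp_rw [← sum_neg_distrib]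
      exact sum_congr rfl fun y _ ↦ sum_congr rfl fun x _ ↦ hg y x
    omega
  have h1 : ∀ x, ∑ y, g x y = ∑ y ∈ X, g x y + ∑ y ∈ Xᶜ, g x y :=
    fun x ↦ (sum_add_sum_compl X _).symm
  simp_rw [h1, sum_add_distrib, h0, zero_add]

/-- **Max-flow min-cut**, for integral capacities and net flows. -/
lemma exists_flow {u v : V} (k : ℕ) (c : V → V → ℤ) (hc : ∀ x y, 0 ≤ c x y)
    (hcut : ∀ X : Finset V, u ∈ X → v ∉ X → (k : ℤ) ≤ ∑ x ∈ X, ∑ y ∈ Xᶜ, c x y) :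
    ∃ g : V → V → ℤ, (∀ x y, g y x = -g x y) ∧ (∀ x y, g x y ≤ c x y) ∧
      ∀ x, ∑ y, g x y = k * ((if x = u then 1 else 0) - (if x = v then 1 else 0)) := by
  induction k generalizing c with
  | zero => exact ⟨fun _ _ ↦ 0, by simp, hc, by simp⟩
  | succ k ih =>
    -- Ford–Fulkerson: augment along a path of positive capacity. Subtracting the net flow `arcFlow
    -- p` also raises the capacity of reversed arcs, so a cut separating `u` from `v` loses exactly
    -- 1.
    let D : Digraph V := ⟨fun x y ↦ 0 < c x y⟩
    obtain ⟨p, hp⟩ : ∃ p, D.IsPath u v p := by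
      refine exists_isPath_of_forall_cut fun X hu hv ↦ ?_
      by_contra! hX
      have := hcut X hu hv
      have h0 : ∑ x ∈ X, ∑ y ∈ Xᶜ, c x y ≤ 0 :=
        sum_nonpos fun x hx ↦ sum_nonpos fun y hy ↦ not_lt.1 (hX x hx y (mem_compl.1 hy))
      push_cast at this
      omega
    have hle : ∀ x y, arcFlow p x y ≤ c x y := fun x y ↦ by
      refine (arcFlow_le hp.nodup x y).trans ?_
      split_ifs with h
      · exact adj_of_mem_arcs hp.chain h
      · exact hc x y
    obtain ⟨g, hg1, hg2, hg3⟩ := ih (fun x y ↦ c x y - arcFlow p x y)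
      (fun x y ↦ sub_nonneg.2 (hle x y)) (fun X hu hv ↦ by
        have h1 := hcut X hu hv
        have h2 := sum_source_sub_sink hu hv 1
        simp_rw [one_mul, ← sum_arcFlow hp] at h2
        rw [← sum_sum_compl_eq (arcFlow_antisymm p)] at h2
        simp_rw [sum_sub_distrib]
        push_cast at h1
        omega)
    refine ⟨fun x y ↦ g x y + arcFlow p x y, fun x y ↦ ?_, fun x y ↦ ?_, fun x ↦ ?_⟩
    · dsimp only; rw [hg1, arcFlow_antisymm]; ring
    · have := hg2 x y; dsimp only at this ⊢; omega
    · rw [sum_add_distrib, hg3, sum_arcFlow hp]; push_cast; ring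

/-- A net flow of value `k` and unit capacities decomposes into `k` arc-disjoint paths. -/
lemma exists_paths_of_flow {u v : V} (k : ℕ) (g : V → V → ℤ)
    (hg : ∀ x y, g y x = -g x y) (hg1 : ∀ x y, g x y ≤ 1)
    (hdiv : ∀ x, ∑ y, g x y = k * ((if x = u then 1 else 0) - (if x = v then 1 else 0))) :
    ∃ P : Fin k → List V, (∀ i, (Digraph.mk fun x y ↦ 0 < g x y).IsPath u v (P i)) ∧
      ∀ i j, i ≠ j → List.Disjoint (arcs (P i)) (arcs (P j)) := by
  induction k generalizing g with
  | zero => exact ⟨Fin.elim0, fun i ↦ i.elim0, fun i ↦ i.elim0⟩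
  | succ k ih =>
    let D : Digraph V := ⟨fun x y ↦ 0 < g x y⟩
    obtain ⟨p, hp⟩ : ∃ p, D.IsPath u v p := by
      refine exists_isPath_of_forall_cut fun X hu hv ↦ ?_
      by_contra! hX
      have h1 := sum_sum_compl_eq hg X
      simp_rw [hdiv] at h1
      rw [sum_source_sub_sink hu hv] at h1
      have h0 : ∑ x ∈ X, ∑ y ∈ Xᶜ, g x y ≤ 0 :=
        sum_nonpos fun x hx ↦ sum_nonpos fun y hy ↦ not_lt.1 (hX x hx y (mem_compl.1 hy))
      push_cast at h1
      omega
    -- The path saturates its arcs, so the remaining flow avoids them; this makes the later paths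
    -- disjoint from `p`.
    have hmem : ∀ x y, (x, y) ∈ arcs p → g x y = 1 ∧ arcFlow p x y = 1 := fun x y h ↦ by
      have h1 : 0 < g x y := adj_of_mem_arcs hp.chain h
      have h2 : (y, x) ∉ arcs p := fun h' ↦ by
        have h3 : 0 < g y x := adj_of_mem_arcs hp.chain h'
        rw [hg] at h3; omega
      refine ⟨le_antisymm (hg1 x y) h1, ?_⟩
      unfold arcFlow
      rw [List.count_eq_zero_of_not_mem h2, List.count_eq_one_of_mem (nodup_arcs hp.nodup) h]
      rfl
    have hcase : ∀ x y, g x y - arcFlow p x y ≤ 1 ∧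
        (0 < g x y - arcFlow p x y → 0 < g x y ∧ (x, y) ∉ arcs p) := fun x y ↦ by
      have hxy := hmem x y
      have hyx := hmem y x
      rw [hg, arcFlow_antisymm] at hyx
      have := hg1 x y
      by_cases h1 : (x, y) ∈ arcs p
      · have := hxy h1; simp only [h1, not_true, and_false]; omega
      · by_cases h2 : (y, x) ∈ arcs p
        · have := hyx h2; simp only [h1, not_false_eq_true, and_true]; omega
        · have : arcFlow p x y = 0 := by
            unfold arcFlow
            rw [List.count_eq_zero_of_not_mem h2, List.count_eq_zero_of_not_mem h1]; rfl
          simp only [h1, not_false_eq_true, and_true]; omega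
    obtain ⟨P, hP, hdis⟩ := ih (fun x y ↦ g x y - arcFlow p x y)
      (fun x y ↦ by rw [hg, arcFlow_antisymm]; ring) (fun x y ↦ (hcase x y).1)
      (fun x ↦ by rw [sum_sub_distrib, hdiv, sum_arcFlow hp]; push_cast; ring)
    have hpP : ∀ i, List.Disjoint (arcs p) (arcs (P i)) := fun i e h1 h2 ↦
      ((hcase e.1 e.2).2 (adj_of_mem_arcs (hP i).chain h2)).2 h1
    refine ⟨Fin.cons p P, fun i ↦ ?_, fun i j hij ↦ ?_⟩
    · cases i using Fin.cases with
      | zero => exact hp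
      | succ i => exact (hP i).mono fun x y h ↦ ((hcase x y).2 h).1
    · cases i using Fin.cases with
      | zero =>
        cases j using Fin.cases with
        | zero => exact absurd rfl hij
        | succ j => exact hpP j
      | succ i =>
        cases j using Fin.cases with
        | zero => exact (hpP i).symm
        | succ j => exact hdis i j fun h ↦ hij (congrArg _ h)

end Flow

/-- **Menger's theorem** for arc-disjoint paths: a digraph all of whose cuts have at least `k` arcs
is `k`-arc-strong. -/
theorem isArcStrong_of_forall_cut [Fintype V] {D : Digraph V} {k : ℕ}
    (h : ∀ X : Finset V, X.Nonempty → X ≠ univ →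
      k ≤ {e : V × V | e.1 ∈ X ∧ e.2 ∉ X ∧ D.Adj e.1 e.2}.ncard) : D.IsArcStrong k := by
  classical
  intro u v
  obtain ⟨g, hg1, hg2, hg3⟩ := exists_flow (u := u) (v := v) k
    (fun x y ↦ if D.Adj x y then 1 else 0) (fun x y ↦ by split_ifs <;> simp)
    (fun X hu hv ↦ by
      refine (Nat.cast_le.2 (h X ⟨u, hu⟩ fun hX ↦ hv (hX ▸ mem_univ v))).trans (le_of_eq ?_)
      rw [← sum_product' X Xᶜ (fun x y ↦ if D.Adj x y then (1 : ℤ) else 0), sum_boole,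
        Set.ncard_eq_toFinset_card']
      congr 2
      ext e
      simp [and_assoc])
  obtain ⟨P, hP, hdis⟩ := exists_paths_of_flow k g hg1
    (fun x y ↦ (hg2 x y).trans (by split_ifs <;> simp)) hg3
  refine ⟨P, fun i ↦ (hP i).mono fun x y hxy ↦ ?_, hdis⟩
  by_contra hD
  have := hg2 x y
  simp only [hD, if_false] at this
  exact absurd hxy (not_lt.2 this)

end Digraph

/-! ### Cuts of weighted graphs and uncrossing. -/

namespace WeightedGraph

variable {V : Type*} [Fintype V] [DecidableEq V]

/-- The total weight from `X` to `Y`. -/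
def flux (m : V → V → ℕ) (X Y : Finset V) : ℕ := ∑ x, ∑ y, if x ∈ X ∧ y ∈ Y then m x y else 0

/-- The total weight leaving `X`. -/
def cut (m : V → V → ℕ) (X : Finset V) : ℕ := flux m X Xᶜ

/-- The weight of a single arc. -/
def arc (a b : V) (x y : V) : ℕ := if x = a ∧ y = b then 1 else 0

/-- `X` separates two elements of `T`. -/
def Separates (X T : Finset V) : Prop := (∃ a ∈ T, a ∈ X) ∧ ∃ b ∈ T, b ∉ X

/-- Every set that separates two elements of `T` is left by weight at least `K`. -/
def CutBound (T : Finset V) (K : ℕ) (m : V → V → ℕ) : Prop :=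
  ∀ X, Separates X T → K ≤ cut m X

lemma Separates.compl {X T : Finset V} (h : Separates X T) : Separates Xᶜ T := by
  obtain ⟨⟨a, ha, ha'⟩, b, hb, hb'⟩ := h
  exact ⟨⟨b, hb, by simpa using hb'⟩, a, ha, by simpa using ha'⟩

lemma flux_add (m m' : V → V → ℕ) (X Y : Finset V) :
    flux (m + m') X Y = flux m X Y + flux m' X Y := by
  simp only [flux, ← sum_add_distrib]
  refine sum_congr rfl fun x _ ↦ sum_congr rfl fun y _ ↦ ?_
  split_ifs <;> simp

lemma cut_add (m m' : V → V → ℕ) (X : Finset V) : cut (m + m') X = cut m X + cut m' X :=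
  flux_add _ _ _ _

lemma cut_arc (a b : V) (X : Finset V) : cut (arc a b) X = if a ∈ X ∧ b ∉ X then 1 else 0 := by
  unfold cut flux arc
  rw [sum_eq_single a, sum_eq_single b]
  · simp
  · intro y _ hy; simp [hy]
  · simp
  · intro x _ hx; simp [hx]
  · simp

lemma flux_comm {m : V → V → ℕ} (hm : ∀ x y, m x y = m y x) (X Y : Finset V) :
    flux m X Y = flux m Y X := by
  unfold flux
  rw [sum_comm]
  refine sum_congr rfl fun x _ ↦ sum_congr rfl fun y _ ↦ ?_
  simp only [hm x y, and_comm]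

lemma cut_compl {m : V → V → ℕ} (hm : ∀ x y, m x y = m y x) (X : Finset V) :
    cut m Xᶜ = cut m X := by
  unfold cut
  rw [compl_compl, flux_comm hm]

lemma cut_add_cut_compl {o m : V → V → ℕ} (h : ∀ x y, o x y + o y x = m x y) (X : Finset V) :
    cut o X + cut o Xᶜ = cut m X := by
  have : cut o Xᶜ = flux (fun x y ↦ o y x) X Xᶜ := by
    unfold cut flux
    rw [sum_comm]
    refine sum_congr rfl fun x _ ↦ sum_congr rfl fun y _ ↦ ?_
    simp only [compl_compl, and_comm]
  rw [this, cut, ← flux_add, cut]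
  congr 1
  funext x y
  exact h x y

lemma le_flux {m : V → V → ℕ} {X Y : Finset V} {x y : V} (hx : x ∈ X) (hy : y ∈ Y) :
    m x y ≤ flux m X Y := by
  unfold flux
  calc m x y = if x ∈ X ∧ y ∈ Y then m x y else 0 := by simp [hx, hy]
    _ ≤ ∑ y, if x ∈ X ∧ y ∈ Y then m x y else 0 :=
      single_le_sum (f := fun y ↦ if x ∈ X ∧ y ∈ Y then m x y else 0)
        (fun _ _ ↦ Nat.zero_le _) (mem_univ y)
    _ ≤ _ := single_le_sum (f := fun x ↦ ∑ y, if x ∈ X ∧ y ∈ Y then m x y else 0)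
        (fun _ _ ↦ Nat.zero_le _) (mem_univ x)

lemma exists_of_flux_pos {m : V → V → ℕ} {X Y : Finset V} (h : 0 < flux m X Y) :
    ∃ x ∈ X, ∃ y ∈ Y, 0 < m x y := by
  by_contra! h0
  refine h.ne' (sum_eq_zero fun x _ ↦ sum_eq_zero fun y _ ↦ ?_)
  split_ifs with hxy
  · exact Nat.le_zero.1 (h0 x hxy.1 y hxy.2)
  · rfl

/-- Submodularity, which holds separately for each ordered pair of vertices. -/
lemma cut_inter_add_cut_union_le (m : V → V → ℕ) (X Y : Finset V) :
    cut m (X ∩ Y) + cut m (X ∪ Y) ≤ cut m X + cut m Y := by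
  simp only [cut, flux, ← sum_add_distrib]
  refine sum_le_sum fun x _ ↦ sum_le_sum fun y _ ↦ ?_
  by_cases h1 : x ∈ X <;> by_cases h2 : x ∈ Y <;> by_cases h3 : y ∈ X <;> by_cases h4 : y ∈ Y <;>
    simp [h1, h2, h3, h4]

/-- The three-set uncrossing inequality. -/
lemma three_set_uncrossing {m : V → V → ℕ} (hm : ∀ x y, m x y = m y x) (X Y Z : Finset V) :
    cut m (X ∩ Y ∩ Z) + cut m (X \ (Y ∪ Z)) + cut m (Y \ (X ∪ Z)) + cut m (Z \ (X ∪ Y)) +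
      2 * flux m (X ∩ Y ∩ Z) (X ∪ Y ∪ Z)ᶜ ≤ cut m X + cut m Y + cut m Z := by
  have h2 : ∀ A B, 2 * flux m A B = flux m A B + flux m B A := fun A B ↦ by
    rw [flux_comm hm B A]; ring
  -- For a single ordered pair the inequality can fail, e.g. `x` in one set only and `y` in all
  -- three. Doubling counts each pair in both directions, and then it holds termwise.
  suffices h : 2 * cut m (X ∩ Y ∩ Z) + 2 * cut m (X \ (Y ∪ Z)) + 2 * cut m (Y \ (X ∪ Z)) +
      2 * cut m (Z \ (X ∪ Y)) + 2 * (2 * flux m (X ∩ Y ∩ Z) (X ∪ Y ∪ Z)ᶜ) ≤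
      2 * cut m X + 2 * cut m Y + 2 * cut m Z by omega
  simp only [cut, h2]
  simp only [flux, mul_sum, ← sum_add_distrib]
  refine sum_le_sum fun x _ ↦ sum_le_sum fun y _ ↦ ?_
  by_cases h1 : x ∈ X <;> by_cases h2 : x ∈ Y <;> by_cases h3 : x ∈ Z <;>
    by_cases h4 : y ∈ X <;> by_cases h5 : y ∈ Y <;> by_cases h6 : y ∈ Z <;>
    simp [h1, h2, h3, h4, h5, h6] <;> omega

lemma cut_singleton_eq {s : V} {X : Finset V} (hs : s ∉ X) (m : V → V → ℕ) :
    cut m {s} = flux m {s} X + flux m {s} (insert s X)ᶜ := by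
  simp only [cut, flux, ← sum_add_distrib]
  refine sum_congr rfl fun x _ ↦ sum_congr rfl fun y _ ↦ ?_
  by_cases h1 : x = s <;> by_cases h2 : y = s <;> by_cases h3 : y ∈ X <;>
    simp_all

lemma cut_insert_add {m : V → V → ℕ} (hm : ∀ x y, m x y = m y x) {s : V} {X : Finset V}
    (hs : s ∉ X) :
    cut m (insert s X) + flux m {s} X = cut m X + flux m {s} (insert s X)ᶜ := by
  rw [flux_comm hm {s} X]
  simp only [cut, flux, ← sum_add_distrib]
  refine sum_congr rfl fun x _ ↦ sum_congr rfl fun y _ ↦ ?_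
  by_cases h1 : x = s <;> by_cases h2 : y = s <;> by_cases h3 : y ∈ X <;> by_cases h4 : x ∈ X <;>
    simp_all

/-! ### Splitting off. -/

/-- **Lovász's splitting-off theorem**: at a vertex `s` of positive even degree there is a pair of
edges `s t`, `s u` that can be split off. -/
lemma exists_splittable {m : V → V → ℕ} (hm : ∀ x y, m x y = m y x) {s : V} {T : Finset V}
    (hs : s ∉ T) (hsupp : ∀ x ∉ insert s T, ∀ y ≠ x, m x y = 0) {K : ℕ} (hK : 2 ≤ K)
    (hcut : CutBound T K m) {n : ℕ} (hdeg : cut m {s} = 2 * (n + 1)) :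
    ∃ t u, t ≠ s ∧ u ≠ s ∧ 1 ≤ m s t ∧ 1 ≤ m s u ∧ (t = u → 2 ≤ m s t) ∧
      ∀ X, s ∉ X → Separates X T → t ∈ X → u ∈ X → K + 2 ≤ cut m X := by
  by_contra! hno
  have hT : ∀ u, u ≠ s → 1 ≤ m s u → u ∈ T := fun u hu h ↦ by
    by_contra hu'
    have := hsupp u (by simp [hu, hu']) s hu.symm
    rw [hm] at this; omega
  -- Call such an `X` dangerous. Comparing it with `insert s X` gives `2 * flux m {s} X ≤ cut m {s}
  -- + 1`, and the degree of `s` is even.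
  have hhalf : ∀ X, s ∉ X → Separates X T → cut m X < K + 2 → 2 * flux m {s} X ≤ cut m {s} := by
    intro X hsX hX hlt
    have h1 := hcut (insert s X) (by
      obtain ⟨⟨a, ha, ha'⟩, b, hb, hb'⟩ := hX
      exact ⟨⟨a, ha, mem_insert_of_mem ha'⟩, b, hb, by
        rw [mem_insert, not_or]; exact ⟨fun h ↦ hs (h ▸ hb), hb'⟩⟩)
    have h2 := cut_insert_add hm hsX
    have h3 := cut_singleton_eq hsX m
    omega
  obtain ⟨s', hs', t, hts, hst⟩ := exists_of_flux_pos (m := m) (X := {s}) (Y := {s}ᶜ)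
    (by rw [← cut, hdeg]; omega)
  rw [mem_singleton.1 hs'] at hst
  have hts : t ≠ s := by simpa using hts
  have hcover : ∀ u, u ≠ s → 1 ≤ m s u →
      ∃ X, (s ∉ X ∧ Separates X T ∧ t ∈ X ∧ cut m X < K + 2) ∧ u ∈ X := by
    intro u hu hsu
    by_cases htu : t = u → 2 ≤ m s t
    · obtain ⟨X, h1, h2, h3, h4, h5⟩ := hno t u hts hu hst hsu htu
      exact ⟨X, ⟨h1, h2, h3, h5⟩, h4⟩
    · push Not at htu
      obtain ⟨rfl, hlt⟩ := htu
      have h1 := cut_singleton_eq (X := {t}) (by simpa using hts.symm) m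
      have h2 : flux m {s} {t} = m s t := by
        unfold flux
        rw [sum_eq_single s, sum_eq_single t] <;> simp +contextual
      obtain ⟨x, hx, u, hu', hsu'⟩ := exists_of_flux_pos (m := m) (X := {s})
        (Y := (insert s {t})ᶜ) (by omega)
      obtain rfl := mem_singleton.1 hx
      simp only [mem_compl, mem_insert, mem_singleton, not_or] at hu'
      obtain ⟨X, h1, h2, h3, h4, h5⟩ := hno t u hts hu'.1 hst hsu' (fun h ↦ absurd h.symm hu'.2)
      exact ⟨X, ⟨h1, h2, h3, h5⟩, h3⟩
  classical
  -- Families of dangerous sets through `t` covering all neighbours of `s`. In a minimal one, each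
  -- member has a private neighbour.
  let C : Finset (Finset V) → Prop := fun F ↦
    (∀ X ∈ F, s ∉ X ∧ Separates X T ∧ t ∈ X ∧ cut m X < K + 2) ∧
      ∀ u, u ≠ s → 1 ≤ m s u → ∃ X ∈ F, u ∈ X
  have hC : ∃ F, C F :=
    ⟨univ.filter fun X ↦ s ∉ X ∧ Separates X T ∧ t ∈ X ∧ cut m X < K + 2,
      fun X hX ↦ (mem_filter.1 hX).2, fun u hu hsu ↦ by
        obtain ⟨X, hX, huX⟩ := hcover u hu hsu
        exact ⟨X, mem_filter.2 ⟨mem_univ _, hX⟩, huX⟩⟩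
  obtain ⟨F, hF⟩ := exists_minimal_of_wellFoundedLT C hC
  obtain ⟨hF1, hF2⟩ := hF.prop
  have hpriv : ∀ X ∈ F, ∃ u, u ∈ T ∧ u ∈ X ∧ ∀ Y ∈ F, Y ≠ X → u ∉ Y := by
    intro X hX
    by_contra! hu
    have := hF.le_of_le (y := F.erase X) ⟨fun Y hY ↦ hF1 Y (mem_of_mem_erase hY), fun u hus hsu ↦ by
      obtain ⟨Y, hY, huY⟩ := hF2 u hus hsu
      by_cases hYX : Y = X
      · subst hYX
        obtain ⟨Z, hZ, hne, huZ⟩ := hu u (hT u hus hsu) huY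
        exact ⟨Z, mem_erase.2 ⟨hne, hZ⟩, huZ⟩
      · exact ⟨Y, mem_erase.2 ⟨hYX, hY⟩, huY⟩⟩ (erase_subset _ _)
    exact notMem_erase X F (this hX)
  -- Two members cannot suffice: each holds at most half of the degree of `s`, and the edge `s t` is
  -- counted in both.
  have htwo : ∀ X ∈ F, ∀ Y ∈ F, ∃ Z ∈ F, Z ≠ X ∧ Z ≠ Y := by
    intro X hX Y hY
    by_contra! hXY
    obtain ⟨hsX, hX1, htX, hX2⟩ := hF1 X hX
    obtain ⟨hsY, hY1, htY, hY2⟩ := hF1 Y hY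
    have h1 := hhalf X hsX hX1 hX2
    have h2 := hhalf Y hsY hY1 hY2
    have h3 : cut m {s} + flux m {s} (X ∩ Y) ≤ flux m {s} X + flux m {s} Y := by
      simp only [cut, flux, ← sum_add_distrib]
      refine sum_le_sum fun x _ ↦ sum_le_sum fun y _ ↦ ?_
      by_cases hx : x = s
      · subst hx
        by_cases hy : y = x
        · subst hy; simp [hsX]
        · by_cases h0 : m x y = 0
          · simp [h0]
          · obtain ⟨Z, hZ, hyZ⟩ := hF2 y hy (by omega)
            have hyXY : y ∈ X ∨ y ∈ Y := by
              by_cases hZX : Z = X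
              · exact Or.inl (hZX ▸ hyZ)
              · exact Or.inr (hXY Z hZ hZX ▸ hyZ)
            by_cases hyX : y ∈ X <;> by_cases hyY : y ∈ Y <;> simp_all
      · simp [hx]
    have h4 : m s t ≤ flux m {s} (X ∩ Y) := le_flux (mem_singleton_self s) (mem_inter.2 ⟨htX, htY⟩)
    omega
  obtain ⟨X, hX, -⟩ := hF2 t hts hst
  obtain ⟨Y, hY, hYX, -⟩ := htwo X hX X hX
  obtain ⟨Z, hZ, hZX, hZY⟩ := htwo X hX Y hY
  obtain ⟨x, hxT, hxX, hx⟩ := hpriv X hX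
  obtain ⟨y, hyT, hyY, hy⟩ := hpriv Y hY
  obtain ⟨z, hzT, hzZ, hz⟩ := hpriv Z hZ
  obtain ⟨hsX, hX1, htX, hX2⟩ := hF1 X hX
  obtain ⟨hsY, hY1, htY, hY2⟩ := hF1 Y hY
  obtain ⟨hsZ, hZ1, htZ, hZ2⟩ := hF1 Z hZ
  have htT := hT t hts hst
  -- The four sets on the left separate `T` thanks to `t` and the private neighbours, so `4 * K + 2
  -- ≤ 3 * (K + 1)`, contradicting `2 ≤ K`.
  have h0 := three_set_uncrossing hm X Y Z
  have h1 := hcut (X ∩ Y ∩ Z) ⟨⟨t, htT, by simp [*]⟩, x, hxT, by simp [hx Y hY hYX]⟩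
  have h2 := hcut (X \ (Y ∪ Z)) ⟨⟨x, hxT, by simp [hxX, hx Y hY hYX, hx Z hZ hZX]⟩, t, htT,
    by simp [*]⟩
  have h3 := hcut (Y \ (X ∪ Z)) ⟨⟨y, hyT, by simp [hyY, hy X hX hYX.symm, hy Z hZ hZY]⟩, t, htT,
    by simp [*]⟩
  have h4 := hcut (Z \ (X ∪ Y)) ⟨⟨z, hzT, by simp [hzZ, hz X hX hZX.symm, hz Y hY hZY.symm]⟩, t,
    htT, by simp [*]⟩
  have h5 : m t s ≤ flux m (X ∩ Y ∩ Z) (X ∪ Y ∪ Z)ᶜ := le_flux (by simp [*]) (by simp [*])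
  rw [hm] at h5
  omega

/-! ### The weak orientation theorem. -/

/-- If every edge lies in a tight cut, then some vertex has the least degree possible. -/
lemma exists_cut_singleton_eq {m : V → V → ℕ} (hm : ∀ x y, m x y = m y x) {T : Finset V}
    (hT : 1 < #T) (hsupp : ∀ x ∉ T, ∀ y ≠ x, m x y = 0) {K : ℕ} (hK : 0 < K)
    (hcut : CutBound T K m)
    (htight : ∀ x y, x ≠ y → 0 < m x y → ∃ X, x ∈ X ∧ y ∉ X ∧ Separates X T ∧ cut m X = K) :
    ∃ s ∈ T, cut m {s} = K := by
  have hsupp' : ∀ x y, x ≠ y → 0 < m x y → x ∈ T ∧ y ∈ T := fun x y hxy h ↦ by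
    constructor
    · by_contra hx; rw [hsupp x hx y hxy.symm] at h; omega
    · by_contra hy; rw [hm, hsupp y hy x hxy] at h; omega
  -- A minimal tight set is a singleton: an edge inside it lies in another tight cut, and uncrossing
  -- gives a smaller tight set.
  let C : Finset V → Prop := fun X ↦ X ⊆ T ∧ Separates X T ∧ cut m X = K
  have hinter : ∀ X, Separates X T → cut m X ≤ K → C (X ∩ T) := fun X hX h ↦ by
    have hsep : Separates (X ∩ T) T := by
      obtain ⟨⟨a, ha, ha'⟩, b, hb, hb'⟩ := hX
      exact ⟨⟨a, ha, mem_inter.2 ⟨ha', ha⟩⟩, b, hb, fun h ↦ hb' (mem_inter.1 h).1⟩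
    refine ⟨inter_subset_right, hsep, le_antisymm (le_trans ?_ h) (hcut _ hsep)⟩
    simp only [cut, flux]
    refine sum_le_sum fun x _ ↦ sum_le_sum fun y _ ↦ ?_
    by_cases hxy : x = y
    · subst hxy; simp
    · by_cases h0 : m x y = 0
      · simp [h0]
      · have := hsupp' x y hxy (by omega)
        simp [this]
  obtain ⟨a, ha, b, hb, hab⟩ := one_lt_card.1 hT
  obtain ⟨X, hX⟩ := exists_minimal_of_wellFoundedLT C (by
    have h1 : Separates {a} T := ⟨⟨a, ha, mem_singleton_self a⟩, b, hb, by simpa using hab.symm⟩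
    obtain ⟨x, hx, y, hy, hxy⟩ := exists_of_flux_pos (m := m) (X := {a}) (Y := {a}ᶜ)
      (hK.trans_le (hcut _ h1))
    obtain ⟨X, -, -, h2, h3⟩ := htight x y (by rintro rfl; exact mem_compl.1 hy hx) hxy
    exact ⟨_, hinter X h2 h3.le⟩)
  obtain ⟨hXT, hX1, hX2⟩ := hX.prop
  have hsmall : ∀ Y, Separates (X ∩ Y) T → cut m (X ∩ Y) ≤ K → X ⊆ Y := fun Y h1 h2 x hx ↦
    (mem_inter.1 (mem_inter.1 (hX.le_of_le (hinter _ h1 h2)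
      (inter_subset_left.trans inter_subset_left) hx)).1).2
  obtain ⟨⟨c, hcT, hcX⟩, d, hdT, hdX⟩ := hX1
  by_cases hone : X = {c}
  · exact ⟨c, hcT, hone ▸ hX2⟩
  exfalso
  obtain ⟨e, heX, hec⟩ : ∃ e ∈ X, e ≠ c := by
    by_contra! h
    exact hone (eq_singleton_iff_unique_mem.2 ⟨hcX, h⟩)
  by_cases hedge : ∃ x ∈ X, ∃ y ∈ X, x ≠ y ∧ 0 < m x y
  · obtain ⟨x, hx, y, hy, hxy, hpos⟩ := hedge
    obtain ⟨Y, hxY, hyY, hY1, hY2⟩ := htight x y hxy hpos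
    by_cases hu : Separates (X ∪ Y) T
    · have hi : Separates (X ∩ Y) T :=
        ⟨⟨x, hXT hx, mem_inter.2 ⟨hx, hxY⟩⟩, y, hXT hy, fun h ↦ hyY (mem_inter.1 h).2⟩
      have h1 := cut_inter_add_cut_union_le m X Y
      have h2 := hcut _ hu
      exact hyY (hsmall Y hi (by omega) hy)
    -- Here `X ∪ Y` contains `T`, so `X` is uncrossed with `Yᶜ`, which is tight by symmetry.
    · have hdY : d ∈ Y := by
        by_contra hdY
        exact hu ⟨⟨x, hXT hx, mem_union_left _ hx⟩, d, hdT, by simp [hdX, hdY]⟩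
      have hi : Separates (X ∩ Yᶜ) T :=
        ⟨⟨y, hXT hy, by simp [hy, hyY]⟩, x, hXT hx, by simp [hxY]⟩
      have h1 := cut_inter_add_cut_union_le m X Yᶜ
      have h2 := hcut (X ∪ Yᶜ) ⟨⟨x, hXT hx, mem_union_left _ hx⟩, d, hdT, by simp [hdX, hdY]⟩
      rw [cut_compl hm] at h1
      exact mem_compl.1 (hsmall Yᶜ hi (by omega) hx) hxY
  -- Without inner edges, `cut m X` would be at least `cut m {c} + cut m (X.erase c)`, hence at
  -- least `2 * K`.
  · push Not at hedge
    have h1 := hcut {c} ⟨⟨c, hcT, mem_singleton_self c⟩, e, hXT heX, by simpa using hec⟩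
    have h2 := hcut (X.erase c) ⟨⟨e, hXT heX, mem_erase.2 ⟨hec, heX⟩⟩, c, hcT, by simp⟩
    have h3 : cut m {c} + cut m (X.erase c) ≤ cut m X := by
      simp only [cut, flux, ← sum_add_distrib]
      refine sum_le_sum fun x _ ↦ sum_le_sum fun y _ ↦ ?_
      by_cases hxy : x = y
      · subst hxy; simp
      by_cases h0 : x ∈ X ∧ y ∈ X
      · have := hedge x h0.1 y h0.2 hxy
        have : m x y = 0 := by omega
        simp [this]
      · by_cases hxc : x = c <;> by_cases hyc : y = c <;> by_cases hxX : x ∈ X <;>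
          by_cases hyX : y ∈ X <;> simp_all
    omega

/-- Every weighted graph on `T` with cuts of weight at least `2 * k` has an orientation whose cuts
have weight at least `k`. -/
def Orientable (k : ℕ) (T : Finset V) : Prop :=
  -- A loop enters `o x x + o x x` twice, hence the parity condition; splitting off with `t = u`
  -- creates a loop of weight 2.
  ∀ m : V → V → ℕ, (∀ x y, m x y = m y x) → (∀ x, Even (m x x)) →
    (∀ x ∉ T, ∀ y ≠ x, m x y = 0) → CutBound T (2 * k) m →
    ∃ o : V → V → ℕ, (∀ x y, o x y + o y x = m x y) ∧ CutBound T k o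

/-- Undo a splitting: an arc `t u` of the orientation is rerouted through `s`. -/
lemma exists_reroute {m m' o' : V → V → ℕ} {s t u : V} {T : Finset V} {k n : ℕ}
    (hts : t ≠ s) (hus : u ≠ s)
    (hm' : ∀ x y, m' x y + (arc s t x y + arc t s x y + arc s u x y + arc u s x y) =
      m x y + (arc t u x y + arc u t x y))
    (ho' : ∀ x y, o' x y + o' y x = m' x y) (hcut : CutBound T k o') (hs : cut o' {s} = n)
    (hs' : cut o' {s}ᶜ = n) (htu : 1 ≤ o' t u) :
    ∃ o : V → V → ℕ, (∀ x y, o x y + o y x = m x y) ∧ CutBound T k o ∧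
      cut o {s} = n + 1 ∧ cut o {s}ᶜ = n + 1 := by
  let o : V → V → ℕ := fun x y ↦ o' x y + arc t s x y + arc s u x y - arc t u x y
  have ho : ∀ x y, o x y + arc t u x y = o' x y + arc t s x y + arc s u x y := fun x y ↦ by
    have : arc t u x y ≤ o' x y := by
      unfold arc
      split_ifs with h
      · rwa [h.1, h.2]
      · exact Nat.zero_le _
    dsimp only [o]
    omega
  have hoc : ∀ X, cut o X + cut (arc t u) X = cut o' X + cut (arc t s) X + cut (arc s u) X := by
    intro X
    rw [← cut_add, ← cut_add, ← cut_add]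
    congr 1
    funext x y
    exact ho x y
  simp only [cut_arc] at hoc
  have harc : ∀ a b x y : V, arc a b y x = arc b a x y := fun a b x y ↦ by
    simp only [arc, and_comm]
  refine ⟨o, fun x y ↦ ?_, fun X hX ↦ ?_, ?_, ?_⟩
  · have h1 := ho x y
    have h2 := ho y x
    have h3 := ho' x y
    have h4 := hm' x y
    rw [harc t u, harc t s, harc s u] at h2
    omega
  -- A set left by the arc `t u` is left by `t s` or by `s u`, so no cut decreases.
  · have h1 := hcut X hX
    have h2 := hoc X
    by_cases ht : t ∈ X <;> by_cases hu : u ∈ X <;> by_cases hsX : s ∈ X <;>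
      simp [ht, hu, hsX] at h2 <;> omega
  · have h2 := hoc {s}
    simp [hts, hus] at h2
    omega
  · have h2 := hoc {s}ᶜ
    simp [hts, hus] at h2
    omega

/-- If the graphs on `T` are orientable, an orientation can be found that is moreover balanced at an
additional vertex of even degree. -/
lemma Orientable.exists_balanced {k : ℕ} (hk : 0 < k) {T : Finset V} (hT : Orientable k T) {s : V}
    (hsT : s ∉ T) (n : ℕ) (m : V → V → ℕ) (hm : ∀ x y, m x y = m y x) (heven : ∀ x, Even (m x x))
    (hsupp : ∀ x ∉ insert s T, ∀ y ≠ x, m x y = 0) (hcut : CutBound T (2 * k) m)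
    (hdeg : cut m {s} = 2 * n) :
    ∃ o : V → V → ℕ, (∀ x y, o x y + o y x = m x y) ∧ CutBound T k o ∧
      cut o {s} = n ∧ cut o {s}ᶜ = n := by
  induction n generalizing m with
  | zero =>
    obtain ⟨o, ho, hoc⟩ := hT m hm heven (fun x hx y hyx ↦ by
      by_cases hxs : x = s
      · subst hxs
        have : m x y ≤ cut m {x} := le_flux (mem_singleton_self x) (by simpa using hyx)
        omega
      · exact hsupp x (by simp [hxs, hx]) y hyx) hcut
    have := cut_add_cut_compl ho {s}
    exact ⟨o, ho, hoc, by omega, by omega⟩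
  | succ n ih =>
    obtain ⟨t, u, hts, hus, hst, hsu, htu, hsplit⟩ :=
      exists_splittable hm hsT hsupp (by omega) hcut hdeg
    have harc : ∀ a b x y : V, arc a b y x = arc b a x y := fun a b x y ↦ by
      simp only [arc, and_comm]
    let m' : V → V → ℕ := fun x y ↦ m x y + (arc t u x y + arc u t x y) -
      (arc s t x y + arc t s x y + arc s u x y + arc u s x y)
    have hm' : ∀ x y, m' x y + (arc s t x y + arc t s x y + arc s u x y + arc u s x y) =
        m x y + (arc t u x y + arc u t x y) := fun x y ↦ by
      have : arc s t x y + arc t s x y + arc s u x y + arc u s x y ≤ m x y := by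
        have h1 := hm s t
        have h2 := hm s u
        unfold arc
        by_cases hx : x = s
        · subst hx
          simp only [hts.symm, hus.symm, true_and, false_and, if_false]
          by_cases hyt : y = t
          · subst hyt
            by_cases hyu : y = u
            · simpa [hyu] using htu hyu
            · simpa [hyu] using hst
          · by_cases hyu : y = u
            · subst hyu; simpa [hyt] using hsu
            · simp [hyt, hyu]
        · by_cases hy : y = s
          · subst hy
            simp only [hx, hts.symm, hus.symm, and_true, false_and, if_false]
            by_cases hyt : x = t
            · subst hyt
              by_cases hyu : x = u
              · have := htu hyu
                simp [hyu] at this h1 ⊢; omega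
              · simp [hyu]; omega
            · by_cases hyu : x = u
              · subst hyu; simp [hyt]; omega
              · simp [hyt, hyu]
          · simp [hx, hy]
      dsimp only [m']
      omega
    have hsymm : ∀ x y, m' x y = m' y x := fun x y ↦ by
      have h1 := hm' x y
      have h2 := hm' y x
      have h3 := hm x y
      have h4 := harc s t x y
      have h5 := harc t s x y
      have h6 := harc s u x y
      have h7 := harc u s x y
      have h8 := harc t u x y
      have h9 := harc u t x y
      omega
    have hm'c : ∀ X, cut m' X + (cut (arc s t) X + cut (arc t s) X + cut (arc s u) X +
        cut (arc u s) X) = cut m X + (cut (arc t u) X + cut (arc u t) X) := by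
      intro X
      simp only [← cut_add]
      congr 1
      funext x y
      exact hm' x y
    simp only [cut_arc] at hm'c
    have htT : ∀ t, t ≠ s → 1 ≤ m s t → t ∈ T := fun t hts hst ↦ by
      by_contra htT
      have := hsupp t (by simp [hts, htT]) s hts.symm
      rw [hm] at this; omega
    obtain ⟨o', ho', hoc', hos, hos'⟩ := ih m' hsymm (fun x ↦ by
        have h1 := hm' x x
        have h2 := heven x
        rw [harc s t, harc s u, harc t u] at h1
        rw [Nat.even_iff] at h2 ⊢
        omega) (fun x hx y hyx ↦ by
        have h1 := hm' x y
        have h2 := hsupp x hx y hyx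
        have h3 : arc t u x y = 0 := by
          have : x ≠ t := fun h ↦ hx (mem_insert_of_mem (h ▸ htT t hts hst))
          simp [arc, this]
        have h4 : arc u t x y = 0 := by
          have : x ≠ u := fun h ↦ hx (mem_insert_of_mem (h ▸ htT u hus hsu))
          simp [arc, this]
        omega) (by
        -- For `s ∉ X`, splitting lowers the cut only if `t` and `u` both lie in `X`, and then by 2,
        -- which `hsplit` allows.
        have key : ∀ X, s ∉ X → Separates X T → 2 * k ≤ cut m' X := fun X hsX hX ↦ by
          have h1 := hm'c X
          have h2 := hcut X hX
          have h3 := hsplit X hsX hX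
          by_cases ht : t ∈ X <;> by_cases hu : u ∈ X <;> simp [ht, hu, hsX] at h1 h3 <;> omega
        intro X hX
        by_cases hsX : s ∈ X
        · rw [← cut_compl hsymm]
          exact key Xᶜ (by simpa using hsX) hX.compl
        · exact key X hsX hX) (by
        have h1 := hm'c {s}
        simp [hts, hus] at h1
        omega)
    have hpos : 1 ≤ o' t u + o' u t := by
      have h1 := ho' t u
      have h2 := hm' t u
      have h3 : arc t u t u = 1 := by simp [arc]
      have h4 : arc s t t u + arc t s t u + arc s u t u + arc u s t u = 0 := by
        simp [arc, hts, hus]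
      omega
    by_cases h : 1 ≤ o' t u
    · exact exists_reroute hts hus hm' ho' hoc' hos hos' h
    · exact exists_reroute hus hts (fun x y ↦ by have := hm' x y; omega) ho' hoc' hos hos'
        (by omega)

/-- The weak orientation theorem of **Nash-Williams**, for weighted graphs. -/
theorem orientable {k : ℕ} (hk : 0 < k) (T : Finset V) : Orientable k T := by
  induction hT : #T using Nat.strong_induction_on generalizing T with
  | _ c ihT =>
  subst hT
  intro m
  induction hN : ∑ x, ∑ y, m x y using Nat.strong_induction_on generalizing m with
  | _ N ihN =>
  subst hN
  intro hm heven hsupp hcut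
  by_cases hT : 1 < #T
  swap
  · refine ⟨fun x y ↦ m x y / 2, fun x y ↦ ?_, fun X hX ↦ ?_⟩
    · by_cases hxy : x = y
      · subst hxy
        have := heven x
        rw [Nat.even_iff] at this
        dsimp only
        omega
      · have h0 : m x y = 0 := by
          by_cases hx : x ∈ T
          · have hy : y ∉ T := fun hy ↦ hT (one_lt_card.2 ⟨x, hx, y, hy, hxy⟩)
            rw [hm, hsupp y hy x hxy]
          · exact hsupp x hx y (Ne.symm hxy)
        simp [hm y x, h0]
    · obtain ⟨⟨a, ha, haX⟩, b, hb, hbX⟩ := hX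
      exact absurd (one_lt_card.2 ⟨a, ha, b, hb, fun h ↦ hbX (h ▸ haX)⟩) hT
  have harc : ∀ a b x y : V, arc a b y x = arc b a x y := fun a b x y ↦ by
    simp only [arc, and_comm]
  -- An edge in no tight cut is deleted, and put back in an arbitrary direction after orienting the
  -- rest.
  by_cases hdel : ∃ a b, a ≠ b ∧ 0 < m a b ∧
      ∀ X, Separates X T → a ∈ X → b ∉ X → 2 * k + 1 ≤ cut m X
  · obtain ⟨a, b, hab, hpos, hX⟩ := hdel
    let m' : V → V → ℕ := fun x y ↦ m x y - (arc a b x y + arc b a x y)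
    have hm' : ∀ x y, m' x y + (arc a b x y + arc b a x y) = m x y := fun x y ↦ by
      have : arc a b x y + arc b a x y ≤ m x y := by
        have := hm a b
        unfold arc
        by_cases h1 : x = a ∧ y = b
        · obtain ⟨rfl, rfl⟩ := h1; simp [hab]; omega
        · by_cases h2 : x = b ∧ y = a
          · obtain ⟨rfl, rfl⟩ := h2; simp [hab.symm]; omega
          · simp [h1, h2]
      dsimp only [m']
      omega
    have hsymm : ∀ x y, m' x y = m' y x := fun x y ↦ by
      have h1 := hm' x y
      have h2 := hm' y x
      have h3 := hm x y
      have h4 := harc a b x y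
      have h5 := harc b a x y
      omega
    have hm'c : ∀ X, cut m' X + (cut (arc a b) X + cut (arc b a) X) = cut m X := by
      intro X
      simp only [← cut_add]
      congr 1
      funext x y
      exact hm' x y
    simp only [cut_arc] at hm'c
    obtain ⟨o, ho, hoc⟩ := ihN (∑ x, ∑ y, m' x y) (by
        have hle : ∀ x y, m' x y ≤ m x y := fun x y ↦ by have := hm' x y; omega
        refine sum_lt_sum (fun x _ ↦ sum_le_sum fun y _ ↦ hle x y) ⟨a, mem_univ a,
          sum_lt_sum (fun y _ ↦ hle a y) ⟨b, mem_univ b, ?_⟩⟩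
        have h1 := hm' a b
        have h2 : arc a b a b = 1 := by simp [arc]
        omega) m' rfl hsymm (fun x ↦ by
        have h1 := hm' x x
        have h2 := heven x
        rw [harc a b] at h1
        rw [Nat.even_iff] at h2 ⊢
        omega) (fun x hx y hyx ↦ by
        have h1 := hm' x y
        have h2 := hsupp x hx y hyx
        omega) (fun X hXT ↦ by
        have h1 := hm'c X
        have h2 := hcut X hXT
        have h3 := hX X hXT
        have h4 := hX Xᶜ hXT.compl
        rw [cut_compl hm] at h4
        by_cases ha : a ∈ X <;> by_cases hb : b ∈ X <;> simp [ha, hb] at h1 h3 h4 <;> omega)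
    refine ⟨o + arc a b, fun x y ↦ ?_, fun X hXT ↦ ?_⟩
    · have h1 := ho x y
      have h2 := hm' x y
      simp only [Pi.add_apply]
      rw [harc a b x y]
      omega
    · rw [cut_add]
      exact (hoc X hXT).trans (Nat.le_add_right _ _)
  push Not at hdel
  -- Otherwise some `s` has degree exactly `2 * k`. Balancing it gives in- and out-weight `k`, which
  -- handles the sets separating only `s` from the rest of `T`.
  obtain ⟨s, hsT, hs⟩ := exists_cut_singleton_eq hm hT hsupp (by omega : 0 < 2 * k) hcut
    (fun x y hxy hpos ↦ by
      obtain ⟨X, hX, hx, hy, hlt⟩ := hdel x y hxy hpos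
      exact ⟨X, hx, hy, hX, le_antisymm (by omega) (hcut X hX)⟩)
  have hsub : ∀ X, Separates X (T.erase s) → Separates X T := fun X hX ↦ by
    obtain ⟨⟨a, ha, haX⟩, b, hb, hbX⟩ := hX
    exact ⟨⟨a, mem_of_mem_erase ha, haX⟩, b, mem_of_mem_erase hb, hbX⟩
  obtain ⟨o, ho, hoc, hout, hin⟩ := (ihT _ (card_erase_lt_of_mem hsT) (T.erase s) rfl).exists_balanced
    hk (notMem_erase s T) k m hm heven (by rwa [insert_erase hsT])
    (fun X hX ↦ hcut X (hsub X hX)) hs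
  refine ⟨o, ho, fun X hX ↦ ?_⟩
  have hzero : ∀ x, x ∉ T.erase s → x ≠ s → o s x = 0 ∧ o x s = 0 := fun x hx hxs ↦ by
    have h1 := ho x s
    have h2 := hsupp x (fun h ↦ hx (mem_erase.2 ⟨hxs, h⟩)) s hxs.symm
    omega
  by_cases h1 : ∃ a ∈ T.erase s, a ∈ X
  · by_cases h2 : ∃ b ∈ T.erase s, b ∉ X
    · exact hoc X ⟨h1, h2⟩
    · push Not at h2
      have hsX : s ∉ X := by
        obtain ⟨-, b, hb, hbX⟩ := hX
        intro hsX
        exact hbX (h2 b (mem_erase.2 ⟨fun h ↦ hbX (h ▸ hsX), hb⟩))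
      rw [← hin]
      simp only [cut, flux]
      refine sum_le_sum fun x _ ↦ sum_le_sum fun y _ ↦ ?_
      by_cases hy : y = s
      · subst hy
        by_cases hx : x = y
        · simp [hx]
        · by_cases hxX : x ∈ X
          · simp [hxX, hsX, hx]
          · simp [(hzero x (fun h ↦ hxX (h2 x h)) hx).2]
      · simp [hy]
  · push Not at h1
    have hsX : s ∈ X := by
      obtain ⟨⟨a, ha, haX⟩, -⟩ := hX
      by_contra hsX
      exact h1 a (mem_erase.2 ⟨fun h ↦ hsX (h ▸ haX), ha⟩) haX
    rw [← hout]
    simp only [cut, flux]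
    refine sum_le_sum fun x _ ↦ sum_le_sum fun y _ ↦ ?_
    by_cases hx : x = s
    · subst hx
      by_cases hy : y = x
      · simp [hy]
      · by_cases hyX : y ∈ X
        · simp [(hzero y (fun h ↦ h1 y h hyX) hy).1]
        · simp [hyX, hsX, hy]
    · simp [hx]

end WeightedGraph

/-! ### Orientations as edge sets, and Pajor's inequality. -/

namespace Digraph

variable {V : Type*}

instance [Finite V] : Finite (Digraph V) :=
  Finite.of_injective Digraph.Adj fun D D' h ↦ by cases D; cases h; rfl

/-- The subgraph of `G` with edge set `B`. -/
def subgraphOfEdges (G : SimpleGraph V) (B : Finset G.edgeSet) : SimpleGraph V where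
  Adj x y := ∃ h : G.Adj x y, (⟨s(x, y), h⟩ : G.edgeSet) ∈ B
  symm := ⟨fun x y ⟨h, hB⟩ ↦ ⟨h.symm, by
    have : (⟨s(y, x), h.symm⟩ : G.edgeSet) = ⟨s(x, y), h⟩ := Subtype.ext Sym2.eq_swap
    rwa [this]⟩⟩
  loopless := ⟨fun x ⟨h, _⟩ ↦ h.ne rfl⟩

lemma subgraphOfEdges_injective (G : SimpleGraph V) :
    Function.Injective (subgraphOfEdges G) := by
  intro A B h
  ext ⟨e, he⟩
  induction e with
  | _ x y =>
  have h1 : (subgraphOfEdges G A).Adj x y ↔ (subgraphOfEdges G B).Adj x y := by rw [h]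
  have he' : G.Adj x y := he
  simpa only [subgraphOfEdges, he', exists_true_left] using h1

lemma exists_subgraphOfEdges_eq [Finite V] {G H : SimpleGraph V} (hH : H ≤ G) :
    ∃ B, subgraphOfEdges G B = H := by
  classical
  have := Fintype.ofFinite V
  refine ⟨univ.filter fun e ↦ e.1 ∈ H.edgeSet, ?_⟩
  ext x y
  simp only [subgraphOfEdges, mem_filter, mem_univ, true_and, SimpleGraph.mem_edgeSet]
  exact ⟨fun ⟨_, h⟩ ↦ h, fun h ↦ ⟨hH h, h⟩⟩

variable [LinearOrder V]

/-- The orientation of `G` that directs exactly the edges in `A` upwards. -/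
def ofEdges (G : SimpleGraph V) (A : Finset G.edgeSet) : Digraph V :=
  ⟨fun x y ↦ ∃ h : G.Adj x y, (⟨s(x, y), h⟩ : G.edgeSet) ∈ A ↔ x < y⟩

lemma isOrientationOf_ofEdges (G : SimpleGraph V) (A : Finset G.edgeSet) :
    (ofEdges G A).IsOrientationOf G := by
  have hswap : ∀ x y (h : G.Adj x y) (h' : G.Adj y x),
      (⟨s(y, x), h'⟩ : G.edgeSet) = ⟨s(x, y), h⟩ := fun x y h h' ↦ Subtype.ext Sym2.eq_swap
  refine ⟨fun x y ↦ ⟨fun h ↦ ?_, ?_⟩, ?_⟩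
  · by_cases hA : (⟨s(x, y), h⟩ : G.edgeSet) ∈ A
    · rcases lt_or_gt_of_ne h.ne with hlt | hlt
      · exact Or.inl ⟨h, iff_of_true hA hlt⟩
      · exact Or.inr ⟨h.symm, iff_of_true (by rwa [hswap x y h]) hlt⟩
    · rcases lt_or_gt_of_ne h.ne with hlt | hlt
      · exact Or.inr ⟨h.symm, iff_of_false (by rwa [hswap x y h]) hlt.not_gt⟩
      · exact Or.inl ⟨h, iff_of_false hA hlt.not_gt⟩
  · rintro (⟨h, -⟩ | ⟨h, -⟩)
    · exact h
    · exact h.symm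
  · rintro x y ⟨h, h1⟩ ⟨h', h2⟩
    rw [hswap x y h h'] at h2
    have h3 := h1.symm.trans h2
    rcases lt_or_gt_of_ne h.ne with hlt | hlt
    · exact hlt.not_gt (h3.1 hlt)
    · exact hlt.not_gt (h3.2 hlt)

lemma ofEdges_injective (G : SimpleGraph V) : Function.Injective (ofEdges G) := by
  intro A B h
  ext ⟨e, he⟩
  induction e with
  | _ x y =>
  have h1 : (ofEdges G A).Adj x y ↔ (ofEdges G B).Adj x y := by rw [h]
  have he' : G.Adj x y := he
  simp only [ofEdges, he', exists_true_left] at h1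
  tauto

variable [Finite V]

lemma exists_ofEdges_eq {G : SimpleGraph V} {D : Digraph V} (hD : D.IsOrientationOf G) :
    ∃ A, ofEdges G A = D := by
  classical
  have := Fintype.ofFinite V
  refine ⟨univ.filter fun e ↦ ∃ x y, x < y ∧ D.Adj x y ∧ e.1 = s(x, y), ?_⟩
  ext x y
  simp only [ofEdges, mem_filter, mem_univ, true_and, Sym2.eq_iff]
  constructor
  · rintro ⟨h, h1⟩
    rcases lt_or_gt_of_ne h.ne with hlt | hlt
    · obtain ⟨a, b, hab, hD', ⟨rfl, rfl⟩ | ⟨rfl, rfl⟩⟩ := h1.2 hlt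
      · exact hD'
      · exact absurd hab hlt.not_gt
    · refine ((hD.adj_iff x y).1 h).resolve_right fun hyx ↦ ?_
      exact hlt.not_gt (h1.1 ⟨y, x, hlt, hyx, Or.inr ⟨rfl, rfl⟩⟩)
  · intro h
    refine ⟨(hD.adj_iff x y).2 (Or.inl h), ?_, fun hlt ↦ ⟨x, y, hlt, h, Or.inl ⟨rfl, rfl⟩⟩⟩
    rintro ⟨a, b, hab, hD', ⟨rfl, rfl⟩ | ⟨rfl, rfl⟩⟩
    · exact hab
    · exact absurd hD' (hD.asymm _ _ h)

/-- A finite graph has as many orientations as subgraphs. -/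
lemma ncard_isOrientationOf (G : SimpleGraph V) :
    {D : Digraph V | D.IsOrientationOf G}.ncard = {H : SimpleGraph V | H ≤ G}.ncard := by
  have h1 : {D : Digraph V | D.IsOrientationOf G} = Set.range (ofEdges G) := by
    ext D
    exact ⟨exists_ofEdges_eq, by rintro ⟨A, rfl⟩; exact isOrientationOf_ofEdges G A⟩
  have h2 : {H : SimpleGraph V | H ≤ G} = Set.range (subgraphOfEdges G) := by
    ext H
    exact ⟨exists_subgraphOfEdges_eq, by rintro ⟨A, rfl⟩ x y ⟨h, -⟩; exact h⟩
  rw [h1, h2, ← Set.image_univ, ← Set.image_univ,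
    Set.ncard_image_of_injective _ (ofEdges_injective G),
    Set.ncard_image_of_injective _ (subgraphOfEdges_injective G)]

/-- Pajor's inequality for families of orientations. -/
lemma ncard_orientations_le (G : SimpleGraph V) (P : Digraph V → Prop) :
    {D : Digraph V | D.IsOrientationOf G ∧ P D}.ncard ≤
      {H : SimpleGraph V | H ≤ G ∧ ∀ D₀ : Digraph V, D₀.IsOrientationOf G →
        ∃ D : Digraph V, D.IsOrientationOf G ∧ P D ∧
          ∀ x y, ¬ H.Adj x y → (D.Adj x y ↔ D₀.Adj x y)}.ncard := by
  classical
  have := Fintype.ofFinite V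
  let 𝒜 : Finset (Finset G.edgeSet) := univ.filter fun A ↦ P (ofEdges G A)
  have h1 : {D : Digraph V | D.IsOrientationOf G ∧ P D} = ofEdges G '' (𝒜 : Set _) := by
    ext D
    constructor
    · rintro ⟨hD, hP⟩
      obtain ⟨A, rfl⟩ := exists_ofEdges_eq hD
      exact ⟨A, by simpa [𝒜] using hP, rfl⟩
    · rintro ⟨A, hA, rfl⟩
      exact ⟨isOrientationOf_ofEdges G A, by simpa [𝒜] using hA⟩
  rw [h1, Set.ncard_image_of_injective _ (ofEdges_injective G), Set.ncard_coe_finset]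
  refine (card_le_card_shatterer 𝒜).trans ?_
  -- A shattered `B` is sent to the subgraph with the complementary edges: the orientation can be
  -- prescribed on `B`, that is, outside `H`.
  rw [← Set.ncard_coe_finset, ← Set.ncard_image_of_injective _
    ((subgraphOfEdges_injective G).comp compl_injective)]
  refine Set.ncard_le_ncard ?_ (Set.toFinite _)
  rintro _ ⟨B, hB, rfl⟩
  refine ⟨fun x y ⟨h, _⟩ ↦ h, fun D₀ hD₀ ↦ ?_⟩
  obtain ⟨A₀, rfl⟩ := exists_ofEdges_eq hD₀
  obtain ⟨A, hA, hAB⟩ := (mem_shatterer.1 hB) (inter_subset_left : B ∩ A₀ ⊆ B)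
  refine ⟨ofEdges G A, isOrientationOf_ofEdges G A, by simpa [𝒜] using hA, fun x y hxy ↦ ?_⟩
  refine exists_congr fun h ↦ ?_
  have hmem : (⟨s(x, y), h⟩ : G.edgeSet) ∈ B := by
    by_contra hB'
    exact hxy ⟨h, mem_compl.2 hB'⟩
  have h2 := Finset.ext_iff.1 hAB ⟨s(x, y), h⟩
  simp only [mem_inter, hmem, true_and] at h2
  rw [h2]

/-- The reverse of Pajor's inequality, for strongly shattered sets, for families of orientations. -/
lemma le_ncard_orientations (G : SimpleGraph V) (P : Digraph V → Prop) :
    {H : SimpleGraph V | H ≤ G ∧ ∃ D₀ : Digraph V, D₀.IsOrientationOf G ∧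
        ∀ D : Digraph V, D.IsOrientationOf G →
          (∀ x y, H.Adj x y → (D.Adj x y ↔ D₀.Adj x y)) → P D}.ncard ≤
      {D : Digraph V | D.IsOrientationOf G ∧ P D}.ncard := by
  classical
  have h1 := ncard_orientations_le G fun D ↦ ¬ P D
  set U := {H : SimpleGraph V | H ≤ G ∧ ∀ D₀ : Digraph V, D₀.IsOrientationOf G →
        ∃ D : Digraph V, D.IsOrientationOf G ∧ ¬ P D ∧
          ∀ x y, ¬ H.Adj x y → (D.Adj x y ↔ D₀.Adj x y)} with hU
  have h2 : {D : Digraph V | D.IsOrientationOf G ∧ P D}.ncard +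
      {D : Digraph V | D.IsOrientationOf G ∧ ¬ P D}.ncard = {H : SimpleGraph V | H ≤ G}.ncard := by
    rw [← ncard_isOrientationOf, ← Set.ncard_union_eq
      (Set.disjoint_left.2 fun D h h' ↦ h'.2 h.2) (Set.toFinite _) (Set.toFinite _)]
    congr 1
    ext D
    by_cases h : P D <;> simp [h]
  have h3 : ({H : SimpleGraph V | H ≤ G} \ U).ncard + U.ncard =
      {H : SimpleGraph V | H ≤ G}.ncard :=
    Set.ncard_sdiff_add_ncard_of_subset (fun H hH ↦ hH.1) (Set.toFinite _)
  have h4 : {H : SimpleGraph V | H ≤ G ∧ ∃ D₀ : Digraph V, D₀.IsOrientationOf G ∧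
        ∀ D : Digraph V, D.IsOrientationOf G →
          (∀ x y, H.Adj x y → (D.Adj x y ↔ D₀.Adj x y)) → P D}.ncard ≤
      ({H : SimpleGraph V | H ≤ G} \ U).ncard := by
    -- If `G \ H` were in `U`, prescribing `D₀` on `H` would allow an orientation violating `P`.
    refine Set.ncard_le_ncard_of_injOn (fun H ↦ G \ H) ?_ ?_ (Set.toFinite _)
    · rintro H ⟨hH, D₀, hD₀, hD⟩
      refine ⟨show G \ H ≤ G from sdiff_le, fun hU' ↦ ?_⟩
      obtain ⟨D, hDG, hPD, hagree⟩ := hU'.2 D₀ hD₀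
      exact hPD (hD D hDG fun x y hxy ↦ hagree x y (by simp [hxy]))
    · rintro H ⟨hH, -⟩ H' ⟨hH', -⟩ h
      rw [← sdiff_sdiff_eq_self hH, ← sdiff_sdiff_eq_self hH']
      exact congrArg (G \ ·) h
  omega

end Digraph

/-! ### Edge connectivity versus orientations. -/

namespace WeightedGraph

lemma cut_le_ncard {V : Type*} [Fintype V] [DecidableEq V] {o : V → V → ℕ} {r : V → V → Prop}
    (h1 : ∀ x y, o x y ≤ 1) (h2 : ∀ x y, 0 < o x y → r x y) (X : Finset V) :
    cut o X ≤ {e : V × V | e.1 ∈ X ∧ e.2 ∉ X ∧ r e.1 e.2}.ncard := by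
  classical
  rw [Set.ncard_eq_toFinset_card']
  simp only [Set.toFinset_ofPred, card_filter, cut, flux]
  rw [← univ_product_univ, sum_product]
  refine sum_le_sum fun x _ ↦ sum_le_sum fun y _ ↦ ?_
  have h0 : ¬ r x y → o x y = 0 := fun hr ↦ Nat.eq_zero_of_not_pos fun h ↦ hr (h2 x y h)
  by_cases hx : x ∈ X <;> by_cases hy : y ∈ X <;> by_cases hr : r x y <;>
    simp [hx, hy, hr, h0, h1 x y]

end WeightedGraph

namespace SimpleGraph

variable {V : Type*}

/-- Deleting all edges that leave `X` separates `a` from `b`. -/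
lemma IsEdgeConnected.le_ncard [Finite V] {H : SimpleGraph V} {k : ℕ} (hH : H.IsEdgeConnected k)
    {X : Set V} {a b : V} (ha : a ∈ X) (hb : b ∉ X) :
    k ≤ {e : V × V | e.1 ∈ X ∧ e.2 ∉ X ∧ H.Adj e.1 e.2}.ncard := by
  by_contra! hlt
  set F := {e : V × V | e.1 ∈ X ∧ e.2 ∉ X ∧ H.Adj e.1 e.2} with hF
  have hcard : ((fun e : V × V ↦ s(e.1, e.2)) '' F).encard < k := by
    refine (Set.encard_image_le _ _).trans_lt ?_
    rw [← (Set.toFinite F).cast_ncard_eq]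
    exact_mod_cast hlt
  obtain ⟨w⟩ := hH a b hcard
  obtain ⟨d, -, hd1, hd2⟩ := w.exists_boundary_dart X ha hb
  have := d.adj
  rw [deleteEdges_adj] at this
  exact this.2 ⟨(d.fst, d.snd), ⟨hd1, hd2, this.1⟩, rfl⟩

variable [LinearOrder V]

/-- A `2 * k`-edge-connected subgraph of `G` has an orientation all of whose extensions to `G` are
`k`-arc-strong. -/
lemma IsEdgeConnected.exists_orientation [Finite V] {G H : SimpleGraph V} (hHG : H ≤ G) {k : ℕ}
    (hH : H.IsEdgeConnected (2 * k)) :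
    ∃ D₀ : Digraph V, D₀.IsOrientationOf G ∧ ∀ D : Digraph V, D.IsOrientationOf G →
      (∀ x y, H.Adj x y → (D.Adj x y ↔ D₀.Adj x y)) → D.IsArcStrong k := by
  classical
  have := Fintype.ofFinite V
  rcases Nat.eq_zero_or_pos k with rfl | hk
  · exact ⟨_, Digraph.isOrientationOf_ofEdges G ∅, fun D _ _ u v ↦
      ⟨Fin.elim0, fun i ↦ i.elim0, fun i ↦ i.elim0⟩⟩
  let m : V → V → ℕ := fun x y ↦ if H.Adj x y then 1 else 0
  obtain ⟨o, ho, hcut⟩ := WeightedGraph.orientable hk univ m (fun x y ↦ by simp [m, H.adj_comm])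
    (fun x ↦ by simp [m]) (by simp) (fun X ⟨⟨a, _, ha⟩, b, _, hb⟩ ↦ by
      have h1 := hH.le_ncard (X := (X : Set V)) (by simpa using ha) (by simpa using hb)
      refine h1.trans ?_
      rw [Set.ncard_eq_toFinset_card']
      simp only [Set.toFinset_ofPred, card_filter, WeightedGraph.cut, WeightedGraph.flux]
      rw [← univ_product_univ, sum_product]
      refine sum_le_sum fun x _ ↦ sum_le_sum fun y _ ↦ ?_
      by_cases hx : x ∈ X <;> by_cases hy : y ∈ X <;> by_cases hr : H.Adj x y <;> simp_all [m])
  have ho1 : ∀ x y, H.Adj x y → o x y + o y x = 1 := fun x y h ↦ by rw [ho]; simp [m, h]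
  have ho0 : ∀ x y, ¬ H.Adj x y → o x y = 0 := fun x y h ↦ by
    have := ho x y; simp [m, h] at this; omega
  -- Edges of `H` follow `o`; the others are directed upwards, an arbitrary choice.
  refine ⟨⟨fun x y ↦ G.Adj x y ∧ (H.Adj x y → o x y = 1) ∧ (¬ H.Adj x y → x < y)⟩,
    ⟨fun x y ↦ ⟨fun h ↦ ?_, ?_⟩, ?_⟩, fun D hD hagree ↦ ?_⟩
  · by_cases hxy : H.Adj x y
    · have := ho1 x y hxy
      simp only [h, h.symm, hxy, hxy.symm, true_and, forall_true_left, not_true, false_imp_iff,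
        and_true]
      omega
    · have hyx : ¬ H.Adj y x := fun h ↦ hxy h.symm
      simpa [h, h.symm, hxy, hyx] using lt_or_gt_of_ne h.ne
  · rintro (h | h)
    · exact h.1
    · exact h.1.symm
  · rintro x y ⟨h1, h2, h3⟩ ⟨-, h5, h6⟩
    by_cases hxy : H.Adj x y
    · have := ho1 x y hxy
      have := h2 hxy
      have := h5 hxy.symm
      omega
    · exact (h3 hxy).not_gt (h6 fun h ↦ hxy h.symm)
  · refine Digraph.isArcStrong_of_forall_cut fun X ⟨a, ha⟩ hX ↦ ?_
    obtain ⟨b, hb⟩ : ∃ b, b ∉ X := by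
      by_contra! h
      exact hX (eq_univ_of_forall h)
    refine (hcut X ⟨⟨a, mem_univ a, ha⟩, b, mem_univ b, hb⟩).trans
      (WeightedGraph.cut_le_ncard (fun x y ↦ ?_) (fun x y hpos ↦ ?_) X)
    · by_cases h : H.Adj x y
      · have := ho1 x y h; omega
      · rw [ho0 x y h]; omega
    · have h : H.Adj x y := by
        by_contra h
        rw [ho0 x y h] at hpos
        omega
      refine (hagree x y h).2 ⟨hHG h, fun _ ↦ ?_, fun h' ↦ absurd h h'⟩
      have := ho1 x y h
      omega

/-- If the edges of `G` outside `H` can be oriented arbitrarily such that `G` still has a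
`k`-arc-strong orientation, then `H` is `k`-edge-connected. -/
lemma isEdgeConnected_of_forall_orientation {G H : SimpleGraph V} {k : ℕ}
    (h : ∀ D₀ : Digraph V, D₀.IsOrientationOf G → ∃ D : Digraph V, D.IsOrientationOf G ∧
      D.IsArcStrong k ∧ ∀ x y, ¬ H.Adj x y → (D.Adj x y ↔ D₀.Adj x y)) :
    H.IsEdgeConnected k := by
  intro u v s hs
  by_contra hv
  let R : Set V := {w | (H.deleteEdges s).Reachable u w}
  obtain ⟨D, hD, hstrong, hagree⟩ := h
    -- Edges across the boundary of `R` are directed out of `R`, all others upwards.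
    ⟨fun x y ↦ G.Adj x y ∧ (y ∈ R → x ∈ R) ∧ ((x ∈ R → y ∈ R) → x < y)⟩
    ⟨fun x y ↦ ⟨fun hxy ↦ by
        have := lt_or_gt_of_ne hxy.ne
        simp only [hxy, hxy.symm, true_and]
        tauto, by
        rintro (h | h)
        · exact h.1
        · exact h.1.symm⟩, by
      rintro x y ⟨-, h1, h2⟩ ⟨-, h3, h4⟩
      exact (h2 h3).not_gt (h4 h1)⟩
  obtain ⟨P, hP, hdis⟩ := hstrong v u
  have hcross : ∀ i, ∃ e : V × V, e ∈ Digraph.arcs (P i) ∧ e.1 ∉ R ∧ e.2 ∈ R := fun i ↦ by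
    obtain ⟨x, y, h1, h2, h3⟩ := (hP i).exists_mem_arcs (X := Rᶜ) (by exact hv)
      (by simp [R])
    exact ⟨(x, y), h1, h2, by simpa using h3⟩
  choose e he1 he2 he3 using hcross
  -- An arc of `D` entering `R` disagrees with `D₀`, so it comes from `H`; if it survived the
  -- deletion, its tail would be in `R`.
  have hmem : ∀ i, s((e i).1, (e i).2) ∈ s := fun i ↦ by
    by_contra hns
    have hadj : D.Adj (e i).1 (e i).2 := Digraph.adj_of_mem_arcs (hP i).chain (he1 i)
    have hH : H.Adj (e i).1 (e i).2 := by
      by_contra hH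
      exact he2 i (((hagree _ _ hH).1 hadj).2.1 (he3 i))
    have hdel : (H.deleteEdges s).Adj (e i).2 (e i).1 := by
      rw [deleteEdges_adj]
      exact ⟨hH.symm, by rwa [Sym2.eq_swap]⟩
    exact he2 i (SimpleGraph.Reachable.trans (he3 i) hdel.reachable)
  have hinj : Function.Injective fun i ↦ s((e i).1, (e i).2) := by
    intro i j hij
    by_contra hne
    rcases Sym2.eq_iff.1 hij with ⟨h1, h2⟩ | ⟨h1, -⟩
    · have : e i = e j := Prod.ext h1 h2
      exact hdis i j hne (he1 i) (this ▸ he1 j)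
    · exact he2 i (h1 ▸ he3 j)
  have hle : (Set.range fun i ↦ s((e i).1, (e i).2)).encard ≤ s.encard :=
    Set.encard_le_encard (by rintro _ ⟨i, rfl⟩; exact hmem i)
  rw [← Set.image_univ, hinj.encard_image, Set.encard_univ, ENat.card_eq_coe_fintype_card,
    Fintype.card_fin] at hle
  exact absurd hs (not_lt.2 hle)

end SimpleGraph

lemma Digraph.isArcStrong_one {V : Type*} {D : Digraph V} : D.IsArcStrong 1 ↔ D.IsStrong := by
  refine forall₂_congr fun u v ↦ ⟨fun ⟨P, hP, _⟩ ↦ ⟨P 0, hP 0⟩, fun ⟨p, hp⟩ ↦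
    ⟨fun _ ↦ p, fun _ ↦ hp, fun i j hij ↦ absurd (Subsingleton.elim i j) hij⟩⟩

theorem mainTheorem1 {V : Type*} [Finite V] (G : SimpleGraph V) :
    (∀ k : ℕ,
      {H : SimpleGraph V | H ≤ G ∧ H.IsEdgeConnected (2 * k)}.ncard ≤
          {D : Digraph V | D.IsOrientationOf G ∧ D.IsArcStrong k}.ncard ∧
        {D : Digraph V | D.IsOrientationOf G ∧ D.IsArcStrong k}.ncard ≤
          {H : SimpleGraph V | H ≤ G ∧ H.IsEdgeConnected k}.ncard) ∧
    ({H : SimpleGraph V | H ≤ G ∧ H.IsEdgeConnected 2}.ncard ≤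
        {D : Digraph V | D.IsOrientationOf G ∧ D.IsStrong}.ncard ∧
      {D : Digraph V | D.IsOrientationOf G ∧ D.IsStrong}.ncard ≤
        {H : SimpleGraph V | H ≤ G ∧ H.Preconnected}.ncard) := by
  have main : ∀ k : ℕ,
      {H : SimpleGraph V | H ≤ G ∧ H.IsEdgeConnected (2 * k)}.ncard ≤
          {D : Digraph V | D.IsOrientationOf G ∧ D.IsArcStrong k}.ncard ∧
        {D : Digraph V | D.IsOrientationOf G ∧ D.IsArcStrong k}.ncard ≤
          {H : SimpleGraph V | H ≤ G ∧ H.IsEdgeConnected k}.ncard := fun k ↦ by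
    classical
    -- Any linear order serves; the counts do not depend on it.
    let _ : LinearOrder V := linearOrderOfSTO WellOrderingRel
    constructor
    · refine (Set.ncard_le_ncard ?_ (Set.toFinite _)).trans
        (Digraph.le_ncard_orientations G fun D ↦ D.IsArcStrong k)
      exact fun H hH ↦ ⟨hH.1, hH.2.exists_orientation hH.1⟩
    · refine (Digraph.ncard_orientations_le G fun D ↦ D.IsArcStrong k).trans
        (Set.ncard_le_ncard ?_ (Set.toFinite _))
      exact fun H hH ↦ ⟨hH.1, SimpleGraph.isEdgeConnected_of_forall_orientation hH.2⟩
  refine ⟨main, ?_⟩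
  have h := main 1
  simpa only [mul_one, Digraph.isArcStrong_one, SimpleGraph.isEdgeConnected_one] using h
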